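/- Theorem 2.1. Let $G$ be a simply connected real $4$-dimensional Lie group with a left-invariant strictly almost Kähler structure $(g,J,\Omega)$: $g$ is a left-invariant Riemannian metric, $J$ a left-invariant non-integrable almost complex structure (i.e. its Nijenhuis tensor is not identically zero), and $\Omega$ a left-invariant symplectic form, with $\Omega(X,Y)=g(JX,Y)$. Suppose that the Ricci tensor $\rho$ of $g$ is $J$-invariant, i.e. $\rho(JX,JY)=\rho(X,Y)$ for all vector fields $X,Y$. Then there exist real numbers $s$ and $t\neq 0$ and an orthonormal basis $\{e^1,e^2,e^3,e^4\}$ of left-invariant $1$-forms such that $$\Omega=e^1\wedge e^2+e^3\wedge e^4,\qquad Je^1=e^2,\quad Je^3=e^4,$$ where $J$ acts on $1$-forms by $(J\alpha)(X)=-\alpha(JX)$, and $$\begin{aligned} de^1&=-s\,(e^1\wedge e^3-e^2\wedge e^4)+\frac{-s^2+t^2}{2t}\,e^1\wedge e^4+t\,e^2\wedge e^3,\\ de^2&=-\frac{s^2}{t}\,e^1\wedge e^3+s\,(e^1\wedge e^4+e^2\wedge e^3)+\frac{s^2-t^2}{2t}\,e^2\wedge e^4,\\ de^3&=\frac{t^2+s^2}{t}\,e^3\wedge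 e^4,\qquad de^4=0. \end{aligned}$$ Moreover, relative to this orthonormal basis the Ricci tensor is $$\rho=\operatorname{diag}\left(0,\,0,\,-\frac{3(t^2+s^2)^2}{2t^2},\,-\frac{3(t^2+s^2)^2}{2t^2}\right).$$ -/

import Mathlib

open scoped Manifold ContDiff

noncomputable section

namespace LieAK

variable {E : Type*} [NormedAddCommGroup E] [NormedSpace ℝ E]
  {H : Type*} [TopologicalSpace H] {I : ModelWithCorners ℝ E H}
  {G : Type*} [TopologicalSpace G] [ChartedSpace H G] [Group G]

/-! ### Tensor fields on a Lie group and left-invariance -/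

variable (I G) in
/-- Vector fields on `G`. -/
abbrev VField : Type _ := Π x : G, TangentSpace I x

variable (I G) in
/-- One-forms on `G`. -/
abbrev OneForm : Type _ := Π x : G, TangentSpace I x →L[ℝ] ℝ

variable (I G) in
/-- Fields of bilinear forms on `G`. -/
abbrev BilinField : Type _ := Π x : G, TangentSpace I x →L[ℝ] TangentSpace I x →L[ℝ] ℝ

variable (I G) in
/-- Fields of endomorphisms of the tangent spaces of `G`. -/
abbrev EndField : Type _ := Π x : G, TangentSpace I x →L[ℝ] TangentSpace I x

/-- The differential at `x` of the left translation by `a`. -/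
def dL (a x : G) : TangentSpace I x →L[ℝ] TangentSpace I (a * x) :=
  mfderiv I I (fun y : G => a * y) x

/-- Left-invariance of a one-form. -/
def OneForm.IsLeftInvariant (α : OneForm I G) : Prop :=
  ∀ (a x : G) (u : TangentSpace I x), α (a * x) (dL a x u) = α x u

/-- Left-invariance of a field of bilinear forms. -/
def BilinField.IsLeftInvariant (b : BilinField I G) : Prop :=
  ∀ (a x : G) (u v : TangentSpace I x), b (a * x) (dL a x u) (dL a x v) = b x u v

/-- Left-invariance of a field of endomorphisms. -/
def EndField.IsLeftInvariant (A : EndField I G) : Prop :=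
  ∀ (a x : G) (u : TangentSpace I x), A (a * x) (dL a x u) = dL a x (A x u)

/-- The left-invariant vector field whose value at `x` is the tangent vector `u`.
All tensors below are evaluated on tangent vectors through these extensions, which is legitimate
since the expressions in question are tensorial in the extended vectors. -/
def leftExt (x : G) (u : TangentSpace I x) : VField I G :=
  mulInvariantVectorField (I := I) (G := G)
    (show TangentSpace I (1 : G) from (dL x⁻¹ x u : E))

/-- The derivative of the function `f` at `x` in the direction `u`. -/
def dirDeriv (f : G → ℝ) (x : G) (u : TangentSpace I x) : ℝ :=
  mfderiv I 𝓘(ℝ, ℝ) f x u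

/-! ### Exterior calculus -/

/-- The exterior derivative of a one-form,
`dα(U, V) = U(α(V)) - V(α(U)) - α([U, V])`. -/
def dOne (α : OneForm I G) (x : G) (u v : TangentSpace I x) : ℝ :=
  let U := leftExt x u
  let V := leftExt x v
  dirDeriv (fun y => α y (V y)) x u - dirDeriv (fun y => α y (U y)) x v
    - α x (VectorField.mlieBracket I U V x)

/-- The exterior derivative of a two-form,
`dη(U, V, W) = U(η(V, W)) - V(η(U, W)) + W(η(U, V))
  - η([U, V], W) + η([U, W], V) - η([V, W], U)`. -/
def dTwo (η : BilinField I G) (x : G) (u v w : TangentSpace I x) : ℝ :=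
  let U := leftExt x u
  let V := leftExt x v
  let W := leftExt x w
  dirDeriv (fun y => η y (V y) (W y)) x u - dirDeriv (fun y => η y (U y) (W y)) x v
    + dirDeriv (fun y => η y (U y) (V y)) x w
    - η x (VectorField.mlieBracket I U V x) w
    + η x (VectorField.mlieBracket I U W x) v
    - η x (VectorField.mlieBracket I V W x) u

/-- The wedge product of two one-forms, `(α ∧ β)(u, v) = α(u) β(v) - α(v) β(u)`. -/
def wedge (α β : OneForm I G) (x : G) (u v : TangentSpace I x) : ℝ :=
  α x u * β x v - α x v * β x u

/-- The action of an almost complex structure on one-forms, `(Jα)(u) = -α(Ju)`; it is the action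
on vectors transported by the metric duality. -/
def actForm (J : EndField I G) (α : OneForm I G) : OneForm I G :=
  fun x => -((α x).comp (J x))

/-! ### The Nijenhuis tensor -/

/-- The vector field `JX`. -/
def actField (J : EndField I G) (X : VField I G) : VField I G := fun x => J x (X x)

/-- The Nijenhuis tensor `N(U, V) = [JU, JV] - J[JU, V] - J[U, JV] - [U, V]` of an almost complex
structure. -/
def nijenhuis (J : EndField I G) (x : G) (u v : TangentSpace I x) : TangentSpace I x :=
  let U := leftExt x u
  let V := leftExt x v
  VectorField.mlieBracket I (actField J U) (actField J V) x
    - J x (VectorField.mlieBracket I (actField J U) V x)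
    - J x (VectorField.mlieBracket I U (actField J V) x)
    - VectorField.mlieBracket I U V x

/-! ### The Levi-Civita connection and the Ricci tensor -/

/-- The right-hand side of the Koszul formula. -/
def koszul (g : BilinField I G) (X Y Z : VField I G) (x : G) : ℝ :=
  dirDeriv (fun y => g y (Y y) (Z y)) x (X x)
    + dirDeriv (fun y => g y (Z y) (X y)) x (Y x)
    - dirDeriv (fun y => g y (X y) (Y y)) x (Z x)
    + g x (VectorField.mlieBracket I X Y x) (Z x)
    - g x (VectorField.mlieBracket I Y Z x) (X x)
    + g x (VectorField.mlieBracket I Z X x) (Y x)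

/-- The Levi-Civita connection: for a Riemannian metric `g` and smooth fields `X`, `Y`, the vector
`(∇_X Y)(x)` is the unique `v` with `2 g(v, w) = koszul(X, Y, W)` for all `w` in the tangent space
at `x`, where `W` is a field extending `w` (the right-hand side does
not depend on the extension). -/
def leviCivita (g : BilinField I G) (X Y : VField I G) : VField I G := fun x =>
  Classical.epsilon fun v : TangentSpace I x =>
    ∀ w : TangentSpace I x, 2 * g x v w = koszul g X Y (leftExt x w) x

/-- The curvature `R(X, Y)Z = ∇_X ∇_Y Z - ∇_Y ∇_X Z - ∇_{[X, Y]} Z`. -/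
def curvature (g : BilinField I G) (X Y Z : VField I G) : VField I G :=
  leviCivita g X (leviCivita g Y Z) - leviCivita g Y (leviCivita g X Z)
    - leviCivita g (VectorField.mlieBracket I X Y) Z

/-- The Ricci tensor: `ρ(u, v)` is the trace of `w ↦ R(w, u)v` on the tangent space at `x`
(computed in some basis of it). -/
def ricci [FiniteDimensional ℝ E] (g : BilinField I G) (x : G) (u v : TangentSpace I x) : ℝ :=
  let b : Module.Basis (Fin (Module.finrank ℝ E)) ℝ (TangentSpace I x) := Module.finBasis ℝ E
  ∑ i, b.coord i (curvature g (leftExt x (b i)) (leftExt x u) (leftExt x v) x)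

/-! ### Almost Kähler structures -/

variable (I G) in
/-- A left-invariant almost Kähler structure `(g, J, Ω)` on `G`: a left-invariant Riemannian
metric, a left-invariant almost complex structure and a left-invariant symplectic form
with `Ω(X, Y) = g(JX, Y)`. (Smoothness is automatic for left-invariant tensor fields.) -/
structure InvariantAlmostKahler where
  g : BilinField I G
  J : EndField I G
  Ω : BilinField I G
  g_inv : g.IsLeftInvariant
  J_inv : J.IsLeftInvariant
  Ω_inv : Ω.IsLeftInvariant
  g_symm : ∀ (x : G) (u v : TangentSpace I x), g x u v = g x v u
  g_pos : ∀ (x : G) (u : TangentSpace I x), u ≠ 0 → 0 < g x u u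
  J_sq : ∀ (x : G) (u : TangentSpace I x), J x (J x u) = -u
  Ω_alt : ∀ (x : G) (u : TangentSpace I x), Ω x u u = 0
  Ω_nondeg : ∀ (x : G) (u : TangentSpace I x), (∀ v : TangentSpace I x, Ω x u v = 0) → u = 0
  Ω_closed : ∀ (x : G) (u v w : TangentSpace I x), dTwo Ω x u v w = 0
  compat : ∀ (x : G) (u v : TangentSpace I x), Ω x u v = g x (J x u) v

/-- The structure is strictly almost Kähler if `J` is not integrable, i.e. its Nijenhuis tensor
does not vanish identically. -/
def InvariantAlmostKahler.IsStrict (S : InvariantAlmostKahler I G) : Prop :=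
  ∃ (x : G) (u v : TangentSpace I x), nijenhuis S.J x u v ≠ 0

/-- The Ricci tensor of `g` is `J`-invariant. -/
def InvariantAlmostKahler.RicciJInvariant [FiniteDimensional ℝ E]
    (S : InvariantAlmostKahler I G) : Prop :=
  ∀ (x : G) (u v : TangentSpace I x), ricci S.g x (S.J x u) (S.J x v) = ricci S.g x u v

/-- The one-forms `e i` form a coframe which is orthonormal for `g`, with (orthonormal) dual
frame `f`. -/
structure IsOrthonormalCoframe {ι : Type*} [DecidableEq ι] (g : BilinField I G)
    (e : ι → OneForm I G) (f : ι → VField I G) : Prop where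
  span : ∀ x : G, Submodule.span ℝ (Set.range fun i => f i x) = ⊤
  dual : ∀ (x : G) (i j : ι), e i x (f j x) = if i = j then 1 else 0
  orthonormal : ∀ (x : G) (i j : ι), g x (f i x) (f j x) = if i = j then 1 else 0

end LieAK

end

noncomputable section

namespace LieAK

/-! ### Structure constants of almost Kähler Lie algebras in dimension four -/

/-! Left-invariant tensors are constant on left-invariant fields, so the exterior derivative, the
Nijenhuis tensor, the Levi-Civita connection and the Ricci tensor all reduce to algebra in the
structure constants of the Lie algebra.

The Nijenhuis tensor is alternating and J-antilinear in each argument; in dimension four its image,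
if nonzero, is therefore a J-invariant plane. Take a unitary frame whose first two vectors span that
plane (`exists_nijenhuis_frame`), and put θ¹ = e⁰ + i e¹, θ² = e² + i e³. Closedness of Ω then gives
dθ = -ω ∧ θ + (ν θ̄¹θ̄², 0) with ω skew-Hermitian and ν ≠ 0: nine complex unknowns in all.

Modulo the Jacobi identities, the J-anti-invariant part of the Ricci tensor is ν times three linear
forms in ω, which must therefore vanish. The remaining Jacobi identities
(`canonicalConnection_eq_zero`) leave a single coefficient z of ω, with 4|z|² = |ν|²; this is
`exists_isReducedConstants`.

The rotations θᵏ ↦ wₖθᵏ adjust the phases of z and ν independently (`exists_rotate`). Only the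
modulus survives, and the normal form is reached with s = 0. -/

open ComplexConjugate in
/-- The algebraic core of the classification: the complexified Jacobi identities force all
components of the canonical connection to vanish, except the one along the torsion. -/
theorem canonicalConnection_eq_zero {x z p q r ν : ℂ} (hν : ν ≠ 0)
    (h₁ : conj ν * ν = 4 * z * conj z + 2 * conj z * conj q + p * conj p - conj x * p)
    (h₂ : conj ν * q = p * (x - p))
    (h₃ : 4 * x * conj x - x * conj p + q * conj q + r * conj r = 2 * conj z * conj q)
    (h₄ : conj x * q + 3 * conj z * conj x - conj p * q + ν * (p - x) = 0)
    (h₅ : conj p * conj z + 2 * ν * p = 0) :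
    x = 0 ∧ p = 0 ∧ q = 0 ∧ r = 0 ∧ 4 * Complex.normSq z = Complex.normSq ν := by
  have hN : 0 < Complex.normSq ν := Complex.normSq_pos.2 hν
  by_cases hp : p = 0
  · subst hp
    have hq : q = 0 := by simpa [hν] using h₂
    subst hq
    have hz : 4 * Complex.normSq z = Complex.normSq ν := by
      have : ((4 * Complex.normSq z : ℝ) : ℂ) = (Complex.normSq ν : ℝ) := by
        push_cast
        simp only [← Complex.mul_conj]
        simp only [map_zero] at h₁
        linear_combination -h₁
      exact_mod_cast this
    -- Squared moduli give 9|z|²|x|² = |ν|²|x|² = 4|z|²|x|², and z ≠ 0 because ν ≠ 0.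
    have hx : x = 0 := by
      have h : 3 * (conj z * conj x) = ν * x := by
        simp only [map_zero] at h₄
        linear_combination h₄
      have h' := congrArg Complex.normSq h
      simp only [Complex.normSq_mul, Complex.normSq_conj] at h'
      have h3 : Complex.normSq 3 = 9 := by norm_num [Complex.normSq_apply]
      rw [h3, ← hz] at h'
      have : Complex.normSq z * Complex.normSq x = 0 := by linarith
      rcases mul_eq_zero.1 this with h0 | h0
      · linarith
      · exact Complex.normSq_eq_zero.1 h0
    subst hx
    refine ⟨rfl, rfl, rfl, ?_, hz⟩
    simpa using h₃
  -- A nonzero p forces |z|² = 4|ν|², then z̄q̄ = -6|ν|² and p x̄ = |p|² + 3|ν|². Hence |x| > |p|,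
  -- which is incompatible with `h₃`.
  · exfalso
    have hp' : conj p ≠ 0 := by simpa using hp
    have h₅' : p * z + 2 * conj ν * conj p = 0 := by
      simpa [Complex.conj_ofNat] using congrArg conj h₅
    have h₂' : ν * conj q = conj p * (conj x - conj p) := by simpa using congrArg conj h₂
    have hz : z * conj z = 4 * (ν * conj ν) := by
      have : p * conj p * (z * conj z - 4 * (ν * conj ν)) = 0 := by
        linear_combination (p * z) * h₅ - (2 * ν * p) * h₅'
      have := (mul_eq_zero.1 this).resolve_left (mul_ne_zero hp hp')
      linear_combination this
    have hD : 2 * (p * (conj p - conj x)) = conj z * conj q := by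
      have : conj p * (2 * (p * (conj p - conj x)) - conj z * conj q) = 0 := by
        linear_combination (2 * p) * h₂' - (conj q) * h₅
      have := (mul_eq_zero.1 this).resolve_left hp'
      linear_combination this
    have hzq : conj z * conj q = -6 * (ν * conj ν) := by
      linear_combination -(2 / 5) * h₁ - (8 / 5) * hz - (1 / 5) * hD
    have hpx : p * conj x = p * conj p + 3 * (ν * conj ν) := by
      linear_combination -(1 / 2) * hD - (1 / 2) * hzq
    have hpx' : conj p * x = p * conj p + 3 * (ν * conj ν) := by
      have := congrArg conj hpx
      simp only [map_mul, map_add, Complex.conj_conj, Complex.conj_ofNat] at this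
      linear_combination this
    have hX : Complex.normSq p * Complex.normSq x
        = (Complex.normSq p + 3 * Complex.normSq ν) ^ 2 := by
      have : ((Complex.normSq p * Complex.normSq x : ℝ) : ℂ)
          = ((Complex.normSq p + 3 * Complex.normSq ν : ℝ) ^ 2 : ℂ) := by
        push_cast
        simp only [← Complex.mul_conj]
        linear_combination (conj p * x) * hpx + (p * conj p + 3 * (ν * conj ν)) * hpx'
      exact_mod_cast this
    have hsum : 4 * Complex.normSq x - Complex.normSq p + 9 * Complex.normSq ν
        + Complex.normSq q + Complex.normSq r = 0 := by
      have : ((4 * Complex.normSq x - Complex.normSq p + 9 * Complex.normSq ν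
          + Complex.normSq q + Complex.normSq r : ℝ) : ℂ) = 0 := by
        push_cast
        simp only [← Complex.mul_conj]
        linear_combination h₃ + hpx' + 2 * hzq
      exact_mod_cast this
    have hP : 0 < Complex.normSq p := Complex.normSq_pos.2 hp
    -- Multiplying `hsum` by |p|² and inserting `hX` gives a sum of nonnegative terms, among them
    -- 3|p|⁴ > 0, equal to zero.
    nlinarith [Complex.normSq_nonneg q, Complex.normSq_nonneg r, mul_pos hP hN, mul_pos hP hP,
      mul_nonneg hP.le (Complex.normSq_nonneg q), mul_nonneg hP.le (Complex.normSq_nonneg r)]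

/-- The Christoffel symbols, in an orthonormal frame, of the Levi-Civita connection of a metric
Lie algebra with structure constants `C`. -/
def christoffel (C : Fin 4 → Fin 4 → Fin 4 → ℝ) (i j k : Fin 4) : ℝ :=
  (C i j k - C j k i + C k i j) / 2

/-- The Ricci tensor, in an orthonormal frame, of a metric Lie algebra with structure
constants `C`. -/
def ricciCoeff (C : Fin 4 → Fin 4 → Fin 4 → ℝ) (i j : Fin 4) : ℝ :=
  ∑ k, ∑ l, (christoffel C i j l * christoffel C k l k - christoffel C k j l * christoffel C i l k
    - C k i l * christoffel C l j k)

/-- The structure constants of a metric Lie algebra with a closed fundamental form in an orthonormal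
frame `f 0, J f 0, f 2, J f 2` such that the Nijenhuis tensor takes values in the span of
`f 0` and `J f 0`. -/
structure IsAlmostKahlerConstants (C : Fin 4 → Fin 4 → Fin 4 → ℝ) : Prop where
  antisymm : ∀ i j k, C j i k = -C i j k
  jacobi : ∀ i j k l, ∑ m, (C i j m * C m k l + C j k m * C m i l + C k i m * C m j l) = 0
  closed₀ : C 1 2 2 + C 1 3 3 + C 2 3 0 = 0
  closed₁ : C 0 2 2 + C 0 3 3 - C 2 3 1 = 0
  closed₂ : C 0 1 2 - C 0 3 0 - C 1 3 1 = 0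
  closed₃ : C 0 1 3 + C 0 2 0 + C 1 2 1 = 0
  nijenhuis₂ : C 1 3 2 + C 1 2 3 + C 0 3 3 - C 0 2 2 = 0
  nijenhuis₃ : C 1 3 3 - C 1 2 2 - C 0 3 2 - C 0 2 3 = 0

/-- The `J`-invariance of the Ricci tensor in a frame `f 0, J f 0, f 2, J f 2`. -/
structure RicciCoeffInvariant (C : Fin 4 → Fin 4 → Fin 4 → ℝ) : Prop where
  r00 : ricciCoeff C 0 0 = ricciCoeff C 1 1
  r22 : ricciCoeff C 2 2 = ricciCoeff C 3 3
  r01 : ricciCoeff C 0 1 = -ricciCoeff C 1 0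
  r23 : ricciCoeff C 2 3 = -ricciCoeff C 3 2
  r20 : ricciCoeff C 2 0 = ricciCoeff C 3 1
  r30 : ricciCoeff C 3 0 = -ricciCoeff C 2 1

/-- The structure constants with `dθ¹ = z θ¹θ² - z̄ θ¹θ̄² + ν θ̄¹θ̄²`, `dθ² = 2 z̄ θ²θ̄²`, where
`θ¹ = e⁰ + i e¹`, `θ² = e² + i e³`. -/
structure IsReducedConstants (C : Fin 4 → Fin 4 → Fin 4 → ℝ) (z ν : ℂ) : Prop where
  c01 : ∀ k, C 0 1 k = 0
  c02 : C 0 2 = ![-ν.re, -2 * z.im - ν.im, 0, 0]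
  c03 : C 0 3 = ![-ν.im, -2 * z.re + ν.re, 0, 0]
  c12 : C 1 2 = ![2 * z.im - ν.im, ν.re, 0, 0]
  c13 : C 1 3 = ![2 * z.re + ν.re, ν.im, 0, 0]
  c23 : C 2 3 = ![0, 0, 4 * z.im, 4 * z.re]

-- The hypothesis `hν` says that the torsion coefficient is nonzero. Being a nonzero complex number
-- it can be cancelled, which turns the quadratic Ricci conditions into linear ones and makes the
-- Jacobi identities tractable.
set_option maxHeartbeats 4000000 in
theorem IsAlmostKahlerConstants.exists_isReducedConstants {C : Fin 4 → Fin 4 → Fin 4 → ℝ}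
    (hC : IsAlmostKahlerConstants C) (hric : RicciCoeffInvariant C)
    (hν : ¬ (C 1 3 0 + C 1 2 1 + C 0 3 1 - C 0 2 0 = 0
      ∧ C 1 3 1 - C 1 2 0 - C 0 3 0 - C 0 2 1 = 0)) :
    ∃ z ν : ℂ, ν ≠ 0 ∧ 4 * Complex.normSq z = Complex.normSq ν ∧ IsReducedConstants C z ν := by
  obtain ⟨hC', hjac, k0, k1, k2, k3, n2, n3⟩ := hC
  obtain ⟨r00, r22, r01, r23, r20, r30⟩ := hric
  have hdiag : ∀ i k, C i i k = 0 := fun i k => by linarith only [hC' i i k]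
  have h10 := hC' 0 1
  have h20 := hC' 0 2
  have h30 := hC' 0 3
  have h21 := hC' 1 2
  have h31 := hC' 1 3
  have h32 := hC' 2 3
  -- Nine complex coordinates on the 24 - 6 = 18 free real parameters: ω₁₁ = x₁θ¹ + x₂θ² minus its
  -- conjugate, ω₂₂ likewise with y₁ and y₂, ω₂₁ = p₁θ¹ + p₂θ² + q₁θ̄¹ + q₂θ̄², and v is the torsion
  -- coefficient ν.
  obtain ⟨x1r, hx1r⟩ : ∃ a : ℝ, a = -C 0 1 1 / 2 := ⟨_, rfl⟩
  obtain ⟨x1i, hx1i⟩ : ∃ a : ℝ, a = -C 0 1 0 / 2 := ⟨_, rfl⟩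
  obtain ⟨q1r, hq1r⟩ : ∃ a : ℝ, a = C 0 1 3 / 2 := ⟨_, rfl⟩
  obtain ⟨q1i, hq1i⟩ : ∃ a : ℝ, a = -C 0 1 2 / 2 := ⟨_, rfl⟩
  obtain ⟨vr, hvr⟩ : ∃ a : ℝ, a = (C 0 3 1 + C 1 3 0 + C 1 2 1 - C 0 2 0) / 4 := ⟨_, rfl⟩
  obtain ⟨vi, hvi⟩ : ∃ a : ℝ, a = (C 1 3 1 - C 0 3 0 - C 0 2 1 - C 1 2 0) / 4 := ⟨_, rfl⟩
  obtain ⟨p1r, hp1r⟩ : ∃ a : ℝ, a = (C 1 2 1 - C 0 2 0 - C 0 3 1 - C 1 3 0) / 4 := ⟨_, rfl⟩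
  obtain ⟨p1i, hp1i⟩ : ∃ a : ℝ, a = (C 1 3 1 - C 0 3 0 + C 0 2 1 + C 1 2 0) / 4 := ⟨_, rfl⟩
  obtain ⟨x2r, hx2r⟩ : ∃ a : ℝ, a = (C 1 3 0 - C 0 3 1 - C 0 1 3) / 4 := ⟨_, rfl⟩
  obtain ⟨x2i, hx2i⟩ : ∃ a : ℝ, a = (C 1 2 0 - C 0 2 1 - C 0 1 2) / 4 := ⟨_, rfl⟩
  obtain ⟨p2r, hp2r⟩ : ∃ a : ℝ, a = -C 2 3 1 / 2 := ⟨_, rfl⟩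
  obtain ⟨p2i, hp2i⟩ : ∃ a : ℝ, a = -C 2 3 0 / 2 := ⟨_, rfl⟩
  obtain ⟨y2r, hy2r⟩ : ∃ a : ℝ, a = -C 2 3 3 / 2 := ⟨_, rfl⟩
  obtain ⟨y2i, hy2i⟩ : ∃ a : ℝ, a = -C 2 3 2 / 2 := ⟨_, rfl⟩
  obtain ⟨q2r, hq2r⟩ : ∃ a : ℝ, a = (C 0 3 3 - C 0 2 2) / 2 := ⟨_, rfl⟩
  obtain ⟨q2i, hq2i⟩ : ∃ a : ℝ, a = (C 1 2 2 - C 1 3 3) / 2 := ⟨_, rfl⟩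
  obtain ⟨y1r, hy1r⟩ : ∃ a : ℝ, a = (C 1 2 3 - C 1 3 2 - C 2 3 1) / 4 := ⟨_, rfl⟩
  obtain ⟨y1i, hy1i⟩ : ∃ a : ℝ, a = (C 0 2 3 - C 0 3 2 - C 2 3 0) / 4 := ⟨_, rfl⟩
  have h010 : C 0 1 0 = -2 * x1i :=
    by linear_combination (2) * hx1i
  have h011 : C 0 1 1 = -2 * x1r :=
    by linear_combination (2) * hx1r
  have h012 : C 0 1 2 = -2 * q1i :=
    by linear_combination (2) * hq1i
  have h013 : C 0 1 3 = 2 * q1r :=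
    by linear_combination -(2) * hq1r
  have h020 : C 0 2 0 = -q1r - p1r - vr :=
    by linear_combination hq1r + hvr + hp1r + (1/2) * k3
  have h021 : C 0 2 1 = -2 * x2i + q1i + p1i - vi :=
    by linear_combination -hq1i + hvi - hp1i + (2) * hx2i
  have h022 : C 0 2 2 = -p2r - q2r :=
    by linear_combination hp2r + hq2r + (1/2) * k1
  have h023 : C 0 2 3 = -p2i + 2 * y1i - q2i :=
    by linear_combination hp2i + hq2i - (2) * hy1i - (1/2) * n3
  have h030 : C 0 3 0 = -q1i - p1i - vi :=
    by linear_combination hq1i + hvi + hp1i - (1/2) * k2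
  have h031 : C 0 3 1 = -2 * x2r - q1r - p1r + vr :=
    by linear_combination hq1r - hvr + hp1r + (2) * hx2r
  have h032 : C 0 3 2 = p2i - 2 * y1i - q2i :=
    by linear_combination -hp2i + hq2i + (2) * hy1i - (1/2) * n3
  have h033 : C 0 3 3 = -p2r + q2r :=
    by linear_combination hp2r - hq2r + (1/2) * k1
  have h120 : C 1 2 0 = 2 * x2i - q1i + p1i - vi :=
    by linear_combination hq1i + hvi - hp1i - (2) * hx2i
  have h121 : C 1 2 1 = -q1r + p1r + vr :=
    by linear_combination hq1r - hvr - hp1r + (1/2) * k3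
  have h122 : C 1 2 2 = p2i + q2i :=
    by linear_combination -hp2i - hq2i + (1/2) * k0
  have h123 : C 1 2 3 = -p2r + 2 * y1r - q2r :=
    by linear_combination hp2r + hq2r - (2) * hy1r + (1/2) * n2
  have h130 : C 1 3 0 = 2 * x2r + q1r - p1r + vr :=
    by linear_combination -hq1r - hvr + hp1r - (2) * hx2r
  have h131 : C 1 3 1 = -q1i + p1i + vi :=
    by linear_combination hq1i - hvi - hp1i - (1/2) * k2
  have h132 : C 1 3 2 = p2r - 2 * y1r - q2r :=
    by linear_combination -hp2r + hq2r + (2) * hy1r + (1/2) * n2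
  have h133 : C 1 3 3 = p2i - q2i :=
    by linear_combination -hp2i + hq2i + (1/2) * k0
  have h230 : C 2 3 0 = -2 * p2i :=
    by linear_combination (2) * hp2i
  have h231 : C 2 3 1 = -2 * p2r :=
    by linear_combination (2) * hp2r
  have h232 : C 2 3 2 = -2 * y2i :=
    by linear_combination (2) * hy2i
  have h233 : C 2 3 3 = -2 * y2r :=
    by linear_combination (2) * hy2r
  have j0120 := hjac 0 1 2 0
  have j0121 := hjac 0 1 2 1
  have j0122 := hjac 0 1 2 2
  have j0123 := hjac 0 1 2 3
  have j0130 := hjac 0 1 3 0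
  have j0131 := hjac 0 1 3 1
  have j0132 := hjac 0 1 3 2
  have j0133 := hjac 0 1 3 3
  have j0230 := hjac 0 2 3 0
  have j0231 := hjac 0 2 3 1
  have j0232 := hjac 0 2 3 2
  have j0233 := hjac 0 2 3 3
  have j1230 := hjac 1 2 3 0
  have j1232 := hjac 1 2 3 2
  have j1233 := hjac 1 2 3 3
  simp only [ricciCoeff, christoffel, Fin.sum_univ_four, hdiag, h10, h20, h30, h21, h31, h32,
    h010, h011, h012, h013, h020, h021, h022, h023, h030, h031, h032, h033, h120, h121, h122, h123,
    h130, h131, h132, h133, h230, h231, h232, h233]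
    at r00 r22 r01 r23 r20 r30 j0120 j0121 j0122 j0123 j0130 j0131 j0132
      j0133 j0230 j0231 j0232 j0233 j1230 j1232 j1233
  clear hjac hdiag h10 h20 h30 h21 h31 h32
  -- The anti-invariant part of Ricci is three complex equations. Corrected by Jacobi identities
  -- they read v p₁ = 0, v (2x₂ + y₂) = 0 and v (2x₁ + y₁ - p₂) = 0; the terms free of v cancel.
  have npr : vr * p1r - vi * p1i = 0 := by
    linear_combination -(1/8) * r22 - (1/8) * j0123 - (1/8) * j0132
  have npi : vr * p1i + vi * p1r = 0 := by
    linear_combination -(1/8) * r23 + (1/8) * j0122 - (1/8) * j0133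
  have nwr : vr * (2 * x2r + y2r) - vi * (2 * x2i + y2i) = 0 := by
    linear_combination (1/8) * r00 + (1/8) * j0231 + (1/8) * j1230
  have nwi : vr * (2 * x2i + y2i) + vi * (2 * x2r + y2r) = 0 := by
    linear_combination (1/8) * r01 - (1/8) * j0122 - (1/8) * j0133 - (1/4) * j0230
  have nyr : vr * (2 * x1r + y1r - p2r) - vi * (2 * x1i + y1i - p2i) = 0 := by
    linear_combination -(1/4) * r20 - (1/4) * j0121 - (1/4) * j0130
  have nyi : vr * (2 * x1i + y1i - p2i) + vi * (2 * x1r + y1r - p2r) = 0 := by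
    linear_combination -(1/4) * r30 + (1/4) * j0120 - (1/4) * j0131
  have hv : (⟨vr, vi⟩ : ℂ) ≠ 0 := by
    intro h
    apply hν
    have h₁ := congrArg Complex.re h
    have h₂ := congrArg Complex.im h
    simp only [Complex.zero_re, Complex.zero_im] at h₁ h₂
    constructor
    · linear_combination 4 * h₁ - 4 * hvr
    · linear_combination 4 * h₂ - 4 * hvi
  have key : ∀ a b : ℝ, vr * a - vi * b = 0 → vr * b + vi * a = 0 → a = 0 ∧ b = 0 := by
    intro a b ha hb
    have : (⟨vr, vi⟩ : ℂ) * ⟨a, b⟩ = 0 := by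
      apply Complex.ext <;> simpa using by assumption
    have := (mul_eq_zero.1 this).resolve_left hv
    exact ⟨congrArg Complex.re this, congrArg Complex.im this⟩
  obtain ⟨hp1, hp1'⟩ := key _ _ npr npi
  obtain ⟨hw, hw'⟩ := key _ _ nwr nwi
  obtain ⟨hy, hy'⟩ := key _ _ nyr nyi
  clear npr npi nwr nwi nyr nyi r00 r22 r01 r23 r20 r30
  have hy2r : y2r = -2 * x2r := by linarith
  have hy2i : y2i = -2 * x2i := by linarith
  have hy1r : y1r = p2r - 2 * x1r := by linarith
  have hy1i : y1i = p2i - 2 * x1i := by linarith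
  simp only [hp1, hp1', hy2r, hy2i, hy1r, hy1i] at *
  -- With p₁, y₁, y₂ eliminated, the unknowns x, z, p, q, r are x₁, x₂, p₂, q₁, q₂. Each hypothesis
  -- is a complex combination of Jacobi identities, checked on real and imaginary parts.
  obtain ⟨hx, hp, hq, hr, hz⟩ := canonicalConnection_eq_zero (x := ⟨x1r, x1i⟩) (z := ⟨x2r, x2i⟩)
    (p := ⟨p2r, p2i⟩) (q := ⟨q1r, q1i⟩) (r := ⟨q2r, q2i⟩) hv
    (by
      apply Complex.ext <;> simp
      · linear_combination -(1/4) * j0231 + (1/4) * j1230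
      · linear_combination -(1/4) * j0122 - (1/4) * j0133)
    (by
      apply Complex.ext <;> simp
      · linear_combination (1/4) * j0231 + (1/4) * j1230
      · linear_combination (1/4) * j0122 + (1/4) * j0133 + (1/2) * j0230)
    (by
      apply Complex.ext <;> simp
      · linear_combination (1/4) * j0123 - (1/4) * j0132
      · linear_combination -(1/4) * j0122 - (1/4) * j0133)
    (by
      apply Complex.ext <;> simp
      · linear_combination -(1/4) * j0121 - (1/4) * j0130
      · linear_combination (1/4) * j0120 - (1/4) * j0131)
    (by
      apply Complex.ext <;> simp
      · linear_combination -(1/2) * j0121 - (1/2) * j0130 + (1/4) * j0233 + (1/4) * j1232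
      · linear_combination (1/2) * j0120 - (1/2) * j0131 - (1/4) * j0232 + (1/4) * j1233)
  have hxr := congrArg Complex.re hx
  have hxi := congrArg Complex.im hx
  have hpr := congrArg Complex.re hp
  have hpi := congrArg Complex.im hp
  have hqr := congrArg Complex.re hq
  have hqi := congrArg Complex.im hq
  have hrr := congrArg Complex.re hr
  have hri := congrArg Complex.im hr
  simp only [Complex.zero_re, Complex.zero_im] at hxr hxi hpr hpi hqr hqi hrr hri
  subst hxr hxi hpr hpi hqr hqi hrr hri
  refine ⟨⟨x2r, x2i⟩, ⟨vr, vi⟩, hv, hz, ?_⟩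
  constructor
  · intro k
    fin_cases k <;> simp [h010, h011, h012, h013]
  all_goals
    funext k
    fin_cases k <;> simp [h020, h021, h022, h023, h030, h031, h032, h033, h120, h121,
      h122, h123, h130, h131, h132, h133, h230, h231, h232, h233] <;>
      ring

/-! ### Metric Lie algebras with a compatible almost complex structure -/

section LieAlgebra

variable {V : Type*} [LieRing V] [LieAlgebra ℝ V]

/-- An almost Kähler structure on a real Lie algebra. -/
structure IsAlmostKahler (B : V →ₗ[ℝ] V →ₗ[ℝ] ℝ) (J : V →ₗ[ℝ] V) : Prop where
  symm : ∀ u v, B u v = B v u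
  pos : ∀ u, u ≠ 0 → 0 < B u u
  sq : ∀ u, J (J u) = -u
  alt : ∀ u, B (J u) u = 0
  closed : ∀ u v w, B (J ⁅u, v⁆) w - B (J ⁅u, w⁆) v + B (J ⁅v, w⁆) u = 0

/-- A unitary frame `f 0, J f 0, f 2, J f 2`. -/
structure IsUnitaryFrame (B : V →ₗ[ℝ] V →ₗ[ℝ] ℝ) (J : V →ₗ[ℝ] V) (f : Fin 4 → V) : Prop where
  orthonormal : ∀ i j, B (f i) (f j) = if i = j then 1 else 0
  J₀ : J (f 0) = f 1
  J₂ : J (f 2) = f 3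

/-- The structure constants of a Lie algebra in an orthonormal frame. -/
def structureConstants (B : V →ₗ[ℝ] V →ₗ[ℝ] ℝ) (f : Fin 4 → V) (i j k : Fin 4) : ℝ :=
  B ⁅f i, f j⁆ (f k)

/-- The Nijenhuis tensor of an endomorphism of a Lie algebra. -/
def lieNijenhuis (J : V →ₗ[ℝ] V) : V →ₗ[ℝ] V →ₗ[ℝ] V :=
  LinearMap.mk₂ ℝ (fun u v => ⁅J u, J v⁆ - J ⁅J u, v⁆ - J ⁅u, J v⁆ - ⁅u, v⁆)
    (fun u u' v => by simp only [map_add, add_lie]; abel)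
    (fun c u v => by simp only [map_smul, smul_lie, smul_sub])
    (fun u v v' => by simp only [map_add, lie_add]; abel)
    (fun c u v => by simp only [map_smul, lie_smul, smul_sub])

theorem lieNijenhuis_apply (J : V →ₗ[ℝ] V) (u v : V) :
    lieNijenhuis J u v = ⁅J u, J v⁆ - J ⁅J u, v⁆ - J ⁅u, J v⁆ - ⁅u, v⁆ := rfl

theorem lieNijenhuis_self (J : V →ₗ[ℝ] V) (u : V) : lieNijenhuis J u u = 0 := by
  rw [lieNijenhuis_apply, ← lie_skew u (J u), map_neg]
  simp

theorem lieNijenhuis_swap (J : V →ₗ[ℝ] V) (u v : V) :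
    lieNijenhuis J u v = -lieNijenhuis J v u := by
  simp only [lieNijenhuis_apply]
  rw [← lie_skew (J u) (J v), ← lie_skew (J u) v, ← lie_skew u (J v), ← lie_skew u v]
  simp only [map_neg]
  abel

namespace IsAlmostKahler

variable {B : V →ₗ[ℝ] V →ₗ[ℝ] ℝ} {J : V →ₗ[ℝ] V} (h : IsAlmostKahler B J)
include h

theorem skew (u v : V) : B (J u) v = -B u (J v) := by
  have := h.alt (u + v)
  simp only [map_add, LinearMap.add_apply, h.alt] at this
  rw [h.symm u]
  linarith

theorem isometry (u v : V) : B (J u) (J v) = B u v := by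
  rw [h.skew, h.sq, map_neg, neg_neg]

theorem nijenhuis_J_left (u v : V) : lieNijenhuis J (J u) v = -J (lieNijenhuis J u v) := by
  simp only [lieNijenhuis_apply, h.sq, map_sub, map_neg, neg_lie]
  abel

theorem nijenhuis_J_right (u v : V) : lieNijenhuis J u (J v) = -J (lieNijenhuis J u v) := by
  rw [lieNijenhuis_swap, h.nijenhuis_J_left, lieNijenhuis_swap J v, map_neg, neg_neg]

theorem isUnitaryFrame {a b : V} (ha : B a a = 1) (hb : B b b = 1) (hab : B a b = 0)
    (hJab : B (J a) b = 0) : IsUnitaryFrame B J ![a, J a, b, J b] := by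
  have h1 : B a (J b) = 0 := by have := h.skew a b; linarith
  refine ⟨?_, rfl, rfl⟩
  intro i j
  fin_cases i <;> fin_cases j <;>
    simp [ha, hb, hab, hJab, h1, h.isometry, h.alt, h.symm b a, h.symm b (J a),  h.symm (J b) a,
      h.symm a (J a), h.symm b (J b)]

end IsAlmostKahler

/-! ### Structure equations in a unitary frame -/

namespace IsUnitaryFrame

variable {B : V →ₗ[ℝ] V →ₗ[ℝ] ℝ} {J : V →ₗ[ℝ] V} {f : Fin 4 → V}

theorem linearIndependent (hf : IsUnitaryFrame B J f) : LinearIndependent ℝ f := by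
  rw [Fintype.linearIndependent_iff]
  intro c hc i
  have := congrArg (fun v => B v (f i)) hc
  simpa [hf.orthonormal] using this

theorem span_eq_top (hf : IsUnitaryFrame B J f) (hV : Module.finrank ℝ V = 4) :
    Submodule.span ℝ (Set.range f) = ⊤ :=
  hf.linearIndependent.span_eq_top_of_card_eq_finrank (by simp [hV])

theorem sum_smul (hf : IsUnitaryFrame B J f) (hV : Module.finrank ℝ V = 4) (v : V) :
    ∑ i, B v (f i) • f i = v := by
  have hv : v ∈ Submodule.span ℝ (Set.range f) := hf.span_eq_top hV ▸ Submodule.mem_top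
  obtain ⟨c, rfl⟩ := (Submodule.mem_span_range_iff_exists_fun ℝ).1 hv
  simp [hf.orthonormal]

theorem apply_eq_sum (hf : IsUnitaryFrame B J f) (hV : Module.finrank ℝ V = 4) (u v : V) :
    B u v = ∑ i, B u (f i) * B (f i) v := by
  conv_lhs => rw [← hf.sum_smul hV u]
  simp

theorem J₁ (hf : IsUnitaryFrame B J f) (h : IsAlmostKahler B J) : J (f 1) = -f 0 := by
  rw [← hf.J₀, h.sq]

theorem J₃ (hf : IsUnitaryFrame B J f) (h : IsAlmostKahler B J) : J (f 3) = -f 2 := by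
  rw [← hf.J₂, h.sq]

theorem lie_apply_eq_sum (hf : IsUnitaryFrame B J f) (hV : Module.finrank ℝ V = 4) (u v w : V) :
    B ⁅u, v⁆ w = ∑ i, B u (f i) * B ⁅f i, v⁆ w := by
  conv_lhs => rw [← hf.sum_smul hV u]
  simp [sum_lie]

theorem jacobi (hf : IsUnitaryFrame B J f) (hV : Module.finrank ℝ V = 4) (i j k l : Fin 4) :
    ∑ m, (structureConstants B f i j m * structureConstants B f m k l
      + structureConstants B f j k m * structureConstants B f m i l
      + structureConstants B f k i m * structureConstants B f m j l) = 0 := by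
  simp only [Finset.sum_add_distrib, structureConstants, ← hf.lie_apply_eq_sum hV]
  rw [← LinearMap.add_apply, ← map_add, ← LinearMap.add_apply, ← map_add,
    ← lie_skew ⁅f i, f j⁆, ← lie_skew ⁅f j, f k⁆, ← lie_skew ⁅f k, f i⁆]
  have := lie_jacobi (f i) (f j) (f k)
  rw [show -⁅f k, ⁅f i, f j⁆⁆ + -⁅f i, ⁅f j, f k⁆⁆ + -⁅f j, ⁅f k, f i⁆⁆
    = -(⁅f i, ⁅f j, f k⁆⁆ + ⁅f j, ⁅f k, f i⁆⁆ + ⁅f k, ⁅f i, f j⁆⁆) by abel, this]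
  simp

theorem isAlmostKahlerConstants (hf : IsUnitaryFrame B J f) (h : IsAlmostKahler B J)
    (hV : Module.finrank ℝ V = 4) (h₂ : B (lieNijenhuis J (f 0) (f 2)) (f 2) = 0)
    (h₃ : B (lieNijenhuis J (f 0) (f 2)) (f 3) = 0) :
    IsAlmostKahlerConstants (structureConstants B f) := by
  have hcl := fun i j k => h.closed (f i) (f j) (f k)
  simp only [h.skew] at hcl
  have c0 := hcl 0 1 2
  have c1 := hcl 0 1 3
  have c2 := hcl 0 2 3
  have c3 := hcl 1 2 3
  simp only [lieNijenhuis_apply, map_sub, LinearMap.sub_apply, h.skew] at h₂ h₃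
  simp only [hf.J₀, hf.J₂, hf.J₁ h, hf.J₃ h, map_neg] at c0 c1 c2 c3 h₂ h₃
  refine ⟨?_, hf.jacobi hV, ?_, ?_, ?_, ?_, ?_, ?_⟩
  · intro i j k
    rw [structureConstants, ← lie_skew, map_neg]
    rfl
  all_goals
    simp only [structureConstants]
    linarith only [c0, c1, c2, c3, h₂, h₃]

end IsUnitaryFrame

/-! ### A unitary frame adapted to the Nijenhuis tensor -/

namespace IsAlmostKahler

variable {B : V →ₗ[ℝ] V →ₗ[ℝ] ℝ} {J : V →ₗ[ℝ] V} (h : IsAlmostKahler B J)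
include h

theorem exists_smul_unit {u : V} (hu : u ≠ 0) : ∃ c : ℝ, c ≠ 0 ∧ B (c • u) (c • u) = 1 := by
  have hp := h.pos u hu
  have hs : √(B u u) ≠ 0 := (Real.sqrt_pos.2 hp).ne'
  refine ⟨(√(B u u))⁻¹, inv_ne_zero hs, ?_⟩
  simp only [map_smul, LinearMap.smul_apply, smul_eq_mul]
  field_simp
  rw [Real.sq_sqrt hp.le]

/-- Antilinearity and skew-symmetry express every value of the Nijenhuis tensor through the single
value m on `f 0`, `f 2`, so its image is spanned by m and J m. Starting the frame with any nonzero
value n makes this plane the span of `f 0` and `f 1`. -/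
theorem exists_nijenhuis_frame (hV : Module.finrank ℝ V = 4)
    (hN : ∃ u v, lieNijenhuis J u v ≠ 0) :
    ∃ f, IsUnitaryFrame B J f ∧ lieNijenhuis J (f 0) (f 2) ≠ 0
      ∧ B (lieNijenhuis J (f 0) (f 2)) (f 2) = 0 ∧ B (lieNijenhuis J (f 0) (f 2)) (f 3) = 0 := by
  obtain ⟨u, v, hn⟩ := hN
  set n := lieNijenhuis J u v with hn_def
  obtain ⟨c, hc, hcn⟩ := h.exists_smul_unit hn
  have : FiniteDimensional ℝ V := Module.finite_of_finrank_pos (by omega)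
  -- Two linear conditions on a four-dimensional space: some nonzero y is orthogonal to n and J n.
  obtain ⟨y, hy, hy0⟩ : ∃ y ∈ LinearMap.ker ((B n).prod (B (J n))), y ≠ 0 := by
    apply Submodule.exists_mem_ne_zero_of_ne_bot
    apply LinearMap.ker_ne_bot_of_finrank_lt
    simp [hV]
  replace hy : B n y = 0 ∧ B (J n) y = 0 := by simpa using hy
  obtain ⟨d, hd, hdy⟩ := h.exists_smul_unit hy0
  have hf := h.isUnitaryFrame hcn hdy (by simp [hy.1]) (by simp [hy.2])
  set f := ![c • n, J (c • n), d • y, J (d • y)] with hf_def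
  refine ⟨f, hf, ?_⟩
  set m := lieNijenhuis J (f 0) (f 2) with hm
  obtain ⟨a, b, hab⟩ : ∃ a b : ℝ, n = a • m + b • J m := by
    have h02 : lieNijenhuis J (f 0) (f 2) = m := rfl
    have h20 : lieNijenhuis J (f 2) (f 0) = -m := lieNijenhuis_swap ..
    have h01 : lieNijenhuis J (f 0) (f 1) = 0 := by
      rw [← hf.J₀, h.nijenhuis_J_right, lieNijenhuis_self]; simp
    have h10 : lieNijenhuis J (f 1) (f 0) = 0 := by rw [lieNijenhuis_swap, h01, neg_zero]
    have h23 : lieNijenhuis J (f 2) (f 3) = 0 := by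
      rw [← hf.J₂, h.nijenhuis_J_right, lieNijenhuis_self]; simp
    have h32 : lieNijenhuis J (f 3) (f 2) = 0 := by rw [lieNijenhuis_swap, h23, neg_zero]
    have h12 : lieNijenhuis J (f 1) (f 2) = -J m := by rw [← hf.J₀, h.nijenhuis_J_left]
    have h21 : lieNijenhuis J (f 2) (f 1) = J m := by rw [lieNijenhuis_swap, h12, neg_neg]
    have h03 : lieNijenhuis J (f 0) (f 3) = -J m := by rw [← hf.J₂, h.nijenhuis_J_right]
    have h30 : lieNijenhuis J (f 3) (f 0) = J m := by rw [lieNijenhuis_swap, h03, neg_neg]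
    have h13 : lieNijenhuis J (f 1) (f 3) = -m := by
      rw [← hf.J₂, h.nijenhuis_J_right, h12, map_neg, h.sq]; simp
    have h31 : lieNijenhuis J (f 3) (f 1) = m := by rw [lieNijenhuis_swap, h13, neg_neg]
    rw [hn_def, ← hf.sum_smul hV u, ← hf.sum_smul hV v]
    simp only [Fin.sum_univ_four, map_add, map_smul, LinearMap.add_apply, LinearMap.smul_apply,
      lieNijenhuis_self, h02, h20, h01, h10, h23, h32, h12, h21, h03, h30, h13, h31]
    refine ⟨B u (f 0) * B v (f 2) - B u (f 2) * B v (f 0) - B u (f 1) * B v (f 3)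
        + B u (f 3) * B v (f 1),
      B u (f 2) * B v (f 1) - B u (f 1) * B v (f 2) - B u (f 0) * B v (f 3)
        + B u (f 3) * B v (f 0), ?_⟩
    module
  -- Inverting n = (a + bJ) m with the conjugate a - bJ puts m in the plane of n and J n, hence
  -- orthogonal to y and J y.
  have hm' : (a ^ 2 + b ^ 2) • m = a • n - b • J n := by
    rw [hab]
    simp only [map_add, map_smul, h.sq]
    module
  have hsq : a ^ 2 + b ^ 2 ≠ 0 := by
    intro h0
    have ha : a = 0 := by nlinarith
    have hb : b = 0 := by nlinarith
    exact hn (by rw [hab, ha, hb]; simp)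
  have hy3 : B n (J y) = 0 ∧ B (J n) (J y) = 0 := by
    refine ⟨?_, ?_⟩
    · have := h.skew n y
      linarith [hy.2]
    · rw [h.isometry, hy.1]
  have e2 := congrArg (fun x => B x y) hm'
  have e3 := congrArg (fun x => B x (J y)) hm'
  simp only [map_smul, map_sub, LinearMap.smul_apply, LinearMap.sub_apply, hy.1, hy.2, hy3.1, hy3.2,
    smul_eq_mul, mul_zero, sub_zero, mul_eq_zero, hsq, false_or] at e2 e3
  refine ⟨?_, ?_, ?_⟩
  · intro h0
    exact hn (by rw [hab, h0]; simp)
  · simp [hf_def, e2]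
  · simp [hf_def, e3]

end IsAlmostKahler

/-- The effect of the change of unitary coframe `θ¹ ↦ w₁ θ¹`, `θ² ↦ w₂ θ²`. -/
theorem IsUnitaryFrame.exists_rotate {B : V →ₗ[ℝ] V →ₗ[ℝ] ℝ} {J : V →ₗ[ℝ] V} {f : Fin 4 → V}
    (hf : IsUnitaryFrame B J f) (h : IsAlmostKahler B J) {z ν w₁ w₂ : ℂ}
    (hC : IsReducedConstants (structureConstants B f) z ν)
    (h₁ : Complex.normSq w₁ = 1) (h₂ : Complex.normSq w₂ = 1) :
    ∃ f', IsUnitaryFrame B J f' ∧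
      IsReducedConstants (structureConstants B f') (z * star w₂) (ν * w₁ ^ 2 * w₂) := by
  rw [Complex.normSq_apply] at h₁ h₂
  have ho := hf.orthonormal
  -- The vectors rotate by the conjugates of w₁ and w₂, so that the dual coframe rotates by w₁ and
  -- w₂ themselves.
  have h' := h.isUnitaryFrame (a := w₁.re • f 0 - w₁.im • f 1) (b := w₂.re • f 2 - w₂.im • f 3)
    (by simp [ho]; linarith) (by simp [ho]; linarith) (by simp [ho])
    (by simp [ho, hf.J₀, hf.J₁ h])
  refine ⟨_, h', ?_⟩
  simp only [map_sub, map_smul, hf.J₀, hf.J₂, hf.J₁ h, hf.J₃ h]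
  obtain ⟨c01, c02, c03, c12, c13, c23⟩ := hC
  have c02 := fun k => congrFun c02 k
  have c03 := fun k => congrFun c03 k
  have c12 := fun k => congrFun c12 k
  have c13 := fun k => congrFun c13 k
  have c23 := fun k => congrFun c23 k
  simp only [structureConstants] at c01 c02 c03 c12 c13 c23
  have hs : ∀ i j k, B ⁅f j, f i⁆ (f k) = -B ⁅f i, f j⁆ (f k) := fun i j k => by
    rw [← lie_skew, map_neg]
    rfl
  have s10 := hs 0 1
  have s32 := hs 2 3
  clear hs
  constructor
  · intro k
    fin_cases k <;>
      simp [structureConstants, c01, s10]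
  all_goals
    funext k
    fin_cases k <;>
      simp [structureConstants, c02, c03, c12, c13, c23, s32, pow_two]
  all_goals
    first
    | ring1
    | linear_combination (-2 * (z.im * w₂.re - z.re * w₂.im)) * h₁
    | linear_combination (2 * (z.im * w₂.re - z.re * w₂.im)) * h₁
    | linear_combination (-2 * (z.re * w₂.re + z.im * w₂.im)) * h₁
    | linear_combination (2 * (z.re * w₂.re + z.im * w₂.im)) * h₁
    | linear_combination (4 * (z.im * w₂.re - z.re * w₂.im)) * h₂
    | linear_combination (4 * (z.re * w₂.re + z.im * w₂.im)) * h₂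

/-- A strictly almost Kähler structure with `J`-invariant Ricci tensor on a four-dimensional Lie
algebra has a unitary frame in which the structure constants depend on one parameter only. -/
theorem IsAlmostKahler.exists_normal_frame {B : V →ₗ[ℝ] V →ₗ[ℝ] ℝ} {J : V →ₗ[ℝ] V}
    (h : IsAlmostKahler B J) (hV : Module.finrank ℝ V = 4) (hN : ∃ u v, lieNijenhuis J u v ≠ 0)
    (hric : ∀ f, IsUnitaryFrame B J f → RicciCoeffInvariant (structureConstants B f)) :
    ∃ (f : Fin 4 → V) (t : ℝ), t ≠ 0 ∧ IsUnitaryFrame B J f ∧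
      IsReducedConstants (structureConstants B f) ⟨0, -(t / 4)⟩ ⟨0, t / 2⟩ := by
  obtain ⟨f, hf, hn, h₂, h₃⟩ := h.exists_nijenhuis_frame hV hN
  obtain ⟨z, ν, hν, hz, hC⟩ :=
    (hf.isAlmostKahlerConstants h hV h₂ h₃).exists_isReducedConstants (hric f hf) (by
      rintro ⟨h₀, h₁⟩
      apply hn
      rw [← hf.sum_smul hV (lieNijenhuis J (f 0) (f 2))]
      have e0 : B (lieNijenhuis J (f 0) (f 2)) (f 0) = 0 := by
        simp only [lieNijenhuis_apply, map_sub, LinearMap.sub_apply, h.skew, hf.J₀, hf.J₂]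
        simp only [structureConstants] at h₀
        linarith only [h₀]
      have e1 : B (lieNijenhuis J (f 0) (f 2)) (f 1) = 0 := by
        simp only [lieNijenhuis_apply, map_sub, LinearMap.sub_apply, h.skew, hf.J₀, hf.J₂,
          hf.J₁ h, map_neg]
        simp only [structureConstants] at h₁
        linarith only [h₁]
      simp [Fin.sum_univ_four, e0, e1, h₂, h₃])
  have hz0 : z ≠ 0 := by
    rintro rfl
    simp only [map_zero, mul_zero] at hz
    exact hν (Complex.normSq_eq_zero.1 hz.symm)
  have hzn : (‖z‖ : ℂ) ≠ 0 := by simpa using hz0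
  have hzs : star z ≠ 0 := by simpa using hz0
  -- Chosen so that z w̄₂ = -i|z|.
  set w₂ : ℂ := Complex.I * ‖z‖ / star z with hw₂
  have hw₂0 : w₂ ≠ 0 := div_ne_zero (mul_ne_zero Complex.I_ne_zero hzn) hzs
  have n₂ : Complex.normSq w₂ = 1 := by
    rw [hw₂, Complex.normSq_eq_norm_sq]
    simp [hz0]
  -- A square root making ν w₁² w₂ = 2i|z|. It has modulus one precisely because |ν| = 2|z|; then t
  -- = 4|z|.
  obtain ⟨w₁, hw₁⟩ := IsAlgClosed.exists_pow_nat_eq (2 * ‖z‖ * Complex.I / (ν * w₂)) two_pos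
  have n₁ : Complex.normSq w₁ = 1 := by
    have e := congrArg Complex.normSq hw₁
    have hνn : Complex.normSq ν ≠ 0 := by simpa using hν
    have h4 : Complex.normSq 2 = 4 := by norm_num [Complex.normSq_apply]
    rw [map_pow, map_div₀, map_mul, map_mul, map_mul, n₂, Complex.normSq_I, Complex.normSq_ofReal,
      Complex.norm_mul_self_eq_normSq, mul_one, mul_one, h4, hz, div_self hνn] at e
    nlinarith [Complex.normSq_nonneg w₁]
  obtain ⟨f', hf', hC'⟩ := hf.exists_rotate h hC n₁ n₂
  refine ⟨f', 4 * ‖z‖, by simpa using hz0, hf', ?_⟩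
  convert hC' using 1
  · have : star w₂ = -Complex.I * ‖z‖ / z := by simp [hw₂]
    rw [this, mul_div_cancel₀ _ hz0]
    apply Complex.ext <;> simp
  · rw [hw₁]
    have : ν * (2 * ‖z‖ * Complex.I / (ν * w₂)) * w₂ = 2 * ‖z‖ * Complex.I := by
      field_simp
    rw [this]
    apply Complex.ext <;> simp
    ring

set_option maxHeartbeats 2000000 in
theorem IsReducedConstants.ricciCoeff_eq {C : Fin 4 → Fin 4 → Fin 4 → ℝ} {t : ℝ}
    (hC : IsReducedConstants C ⟨0, -(t / 4)⟩ ⟨0, t / 2⟩)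
    (hs : ∀ i j k, C j i k = -C i j k) (i j : Fin 4) :
    ricciCoeff C i j = Matrix.diagonal ![0, 0, -3 * t ^ 2 / 2, -3 * t ^ 2 / 2] i j := by
  have hdiag : ∀ i k, C i i k = 0 := fun i k => by linarith only [hs i i k]
  have h10 := hs 0 1
  have h20 := hs 0 2
  have h30 := hs 0 3
  have h21 := hs 1 2
  have h31 := hs 1 3
  have h32 := hs 2 3
  clear hs
  obtain ⟨c01, c02, c03, c12, c13, c23⟩ := hC
  fin_cases i <;> fin_cases j <;>
    simp [ricciCoeff, christoffel, Fin.sum_univ_four, hdiag, h10, h20, h30, h21, h31, h32,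
      c01, c02, c03, c12, c13, c23]
  all_goals ring

/-- The Levi-Civita connection of a metric Lie algebra, computed in an orthonormal frame. -/
def lieLeviCivita (B : V →ₗ[ℝ] V →ₗ[ℝ] ℝ) (f : Fin 4 → V) : V →ₗ[ℝ] V →ₗ[ℝ] V :=
  LinearMap.mk₂ ℝ
    (fun u v => ∑ k, ((B ⁅u, v⁆ (f k) - B ⁅v, f k⁆ u + B ⁅f k, u⁆ v) / 2) • f k)
    (fun u u' v => by
      rw [← Finset.sum_add_distrib]
      refine Finset.sum_congr rfl fun k _ => ?_
      simp only [add_lie, lie_add, map_add, LinearMap.add_apply]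
      module)
    (fun c u v => by
      rw [Finset.smul_sum]
      refine Finset.sum_congr rfl fun k _ => ?_
      simp only [smul_lie, lie_smul, map_smul, LinearMap.smul_apply, smul_eq_mul]
      module)
    (fun u v v' => by
      rw [← Finset.sum_add_distrib]
      refine Finset.sum_congr rfl fun k _ => ?_
      simp only [add_lie, lie_add, map_add, LinearMap.add_apply]
      module)
    (fun c u v => by
      rw [Finset.smul_sum]
      refine Finset.sum_congr rfl fun k _ => ?_
      simp only [smul_lie, lie_smul, map_smul, LinearMap.smul_apply, smul_eq_mul]
      module)

theorem lieLeviCivita_apply (B : V →ₗ[ℝ] V →ₗ[ℝ] ℝ) (f : Fin 4 → V) (u v : V) :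
    lieLeviCivita B f u v
      = ∑ k, ((B ⁅u, v⁆ (f k) - B ⁅v, f k⁆ u + B ⁅f k, u⁆ v) / 2) • f k := rfl

/-- The endomorphism `u ↦ R(u, v)w`, where `R` is the curvature of the connection `D`. -/
def lieCurvature (D : V →ₗ[ℝ] V →ₗ[ℝ] V) (v w : V) : V →ₗ[ℝ] V where
  toFun u := D u (D v w) - D v (D u w) - D ⁅u, v⁆ w
  map_add' u u' := by
    simp only [map_add, LinearMap.add_apply, add_lie]
    abel
  map_smul' c u := by
    simp only [map_smul, LinearMap.smul_apply, smul_lie, smul_sub, RingHom.id_apply]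

theorem lieCurvature_apply (D : V →ₗ[ℝ] V →ₗ[ℝ] V) (u v w : V) :
    lieCurvature D v w u = D u (D v w) - D v (D u w) - D ⁅u, v⁆ w := rfl

theorem lieCurvature_neg_left (D : V →ₗ[ℝ] V →ₗ[ℝ] V) (v w : V) :
    lieCurvature D (-v) w = -lieCurvature D v w := by
  ext u
  simp only [lieCurvature_apply, LinearMap.neg_apply, map_neg, lie_neg]
  abel

theorem lieCurvature_neg_right (D : V →ₗ[ℝ] V →ₗ[ℝ] V) (v w : V) :
    lieCurvature D v (-w) = -lieCurvature D v w := by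
  ext u
  simp only [lieCurvature_apply, LinearMap.neg_apply, map_neg]
  abel

/-! ### Connection, Ricci tensor and brackets in a unitary frame -/

namespace IsUnitaryFrame

variable {B : V →ₗ[ℝ] V →ₗ[ℝ] ℝ} {J : V →ₗ[ℝ] V} {f : Fin 4 → V}

theorem lieLeviCivita_spec (hf : IsUnitaryFrame B J f) (hV : Module.finrank ℝ V = 4) (u v w : V) :
    2 * B (lieLeviCivita B f u v) w = B ⁅u, v⁆ w - B ⁅v, w⁆ u + B ⁅w, u⁆ v := by
  have hw := hf.sum_smul hV w
  have key : ∀ k, 2 * B (lieLeviCivita B f u v) (f k)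
      = B ⁅u, v⁆ (f k) - B ⁅v, f k⁆ u + B ⁅f k, u⁆ v := fun k => by
    simp only [lieLeviCivita_apply, map_sum, map_smul, LinearMap.sum_apply, LinearMap.smul_apply,
      hf.orthonormal, smul_eq_mul, mul_ite, mul_one, mul_zero, Finset.sum_ite_eq',
      Finset.mem_univ, if_true]
    ring
  rw [← hw]
  simp only [map_sum, map_smul, smul_eq_mul, lie_sum, sum_lie, LinearMap.sum_apply, lie_smul,
    smul_lie, LinearMap.smul_apply]
  rw [Finset.mul_sum, ← Finset.sum_sub_distrib, ← Finset.sum_add_distrib]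
  refine Finset.sum_congr rfl fun k _ => ?_
  linear_combination (B w (f k)) * key k

theorem lieLeviCivita_frame (hf : IsUnitaryFrame B J f) (i j k : Fin 4) :
    B (lieLeviCivita B f (f i) (f j)) (f k) = christoffel (structureConstants B f) i j k := by
  simp [lieLeviCivita_apply, hf.orthonormal, christoffel, structureConstants]

theorem map_apply_eq_sum (hf : IsUnitaryFrame B J f) (hV : Module.finrank ℝ V = 4)
    (φ : V →ₗ[ℝ] ℝ) (v : V) : φ v = ∑ i, B v (f i) * φ (f i) := by
  conv_lhs => rw [← hf.sum_smul hV v]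
  simp

theorem trace_eq_sum (hf : IsUnitaryFrame B J f) (hV : Module.finrank ℝ V = 4) (T : V →ₗ[ℝ] V) :
    LinearMap.trace ℝ V T = ∑ i, B (T (f i)) (f i) := by
  let b := Module.Basis.mk hf.linearIndependent (hf.span_eq_top hV).ge
  have hb : ∀ i, b i = f i := fun i => Module.Basis.mk_apply _ _ i
  have hr : ∀ v i, b.repr v i = B v (f i) := fun v i => by
    conv_rhs => rw [← b.sum_repr v]
    simp [hb, hf.orthonormal]
  rw [LinearMap.trace_eq_matrix_trace ℝ b, Matrix.trace]
  refine Finset.sum_congr rfl fun i _ => ?_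
  rw [Matrix.diag_apply, LinearMap.toMatrix_apply, hr, hb]

/-- In an orthonormal frame the trace is the sum of the diagonal entries; expanding the inner
argument of each of the three curvature terms in the frame produces the products of Christoffel
symbols. -/
theorem trace_lieCurvature (hf : IsUnitaryFrame B J f) (hV : Module.finrank ℝ V = 4)
    (i j : Fin 4) :
    LinearMap.trace ℝ V (lieCurvature (lieLeviCivita B f) (f i) (f j))
      = ricciCoeff (structureConstants B f) i j := by
  rw [hf.trace_eq_sum hV, ricciCoeff]
  refine Finset.sum_congr rfl fun k _ => ?_
  have h₁ := fun u v => hf.map_apply_eq_sum hV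
    ((B.flip (f k)).comp (lieLeviCivita B f u)) v
  have h₂ := fun u v => hf.map_apply_eq_sum hV
    ((B.flip (f k)).comp ((lieLeviCivita B f).flip v)) u
  simp only [LinearMap.comp_apply, LinearMap.flip_apply] at h₁ h₂
  rw [lieCurvature_apply, map_sub, map_sub, LinearMap.sub_apply, LinearMap.sub_apply, h₁ (f k),
    h₁ (f i), h₂ ⁅f k, f i⁆, ← Finset.sum_sub_distrib, ← Finset.sum_sub_distrib]
  simp only [hf.lieLeviCivita_frame]
  rfl

theorem fundamentalForm_eq (hf : IsUnitaryFrame B J f) (h : IsAlmostKahler B J)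
    (hV : Module.finrank ℝ V = 4) (a b : V) :
    B (J a) b = (B (f 0) a * B (f 1) b - B (f 0) b * B (f 1) a)
      + (B (f 2) a * B (f 3) b - B (f 2) b * B (f 3) a) := by
  rw [hf.apply_eq_sum hV (J a) b]
  simp only [h.skew, Fin.sum_univ_four, hf.J₀, hf.J₂, hf.J₁ h, hf.J₃ h, map_neg]
  rw [h.symm a (f 0), h.symm a (f 1), h.symm a (f 2), h.symm a (f 3)]
  ring

theorem apply_lie_eq (hf : IsUnitaryFrame B J f) (h : IsAlmostKahler B J)
    (hV : Module.finrank ℝ V = 4) (a b : V) (k : Fin 4) :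
    B (f k) ⁅a, b⁆ =
      (B (f 0) a * B (f 1) b - B (f 0) b * B (f 1) a) * structureConstants B f 0 1 k
      + (B (f 0) a * B (f 2) b - B (f 0) b * B (f 2) a) * structureConstants B f 0 2 k
      + (B (f 0) a * B (f 3) b - B (f 0) b * B (f 3) a) * structureConstants B f 0 3 k
      + (B (f 1) a * B (f 2) b - B (f 1) b * B (f 2) a) * structureConstants B f 1 2 k
      + (B (f 1) a * B (f 3) b - B (f 1) b * B (f 3) a) * structureConstants B f 1 3 k
      + (B (f 2) a * B (f 3) b - B (f 2) b * B (f 3) a) * structureConstants B f 2 3 k := by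
  have hs : ∀ i j, B ⁅f j, f i⁆ (f k) = -B ⁅f i, f j⁆ (f k) := fun i j => by
    rw [← lie_skew, map_neg, LinearMap.neg_apply]
  conv_lhs => rw [h.symm, ← hf.sum_smul hV a, ← hf.sum_smul hV b]
  simp only [Fin.sum_univ_four, lie_add, add_lie, smul_lie, lie_smul, lie_self, map_add, map_smul,
    LinearMap.add_apply, LinearMap.smul_apply, smul_eq_mul, hs 0 1, hs 0 2, hs 0 3, hs 1 2, hs 1 3,
    hs 2 3, map_zero, LinearMap.zero_apply, structureConstants, h.symm a, h.symm b]
  ring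

end IsUnitaryFrame

end LieAlgebra

section LieGroup

variable {E : Type*} [NormedAddCommGroup E] [NormedSpace ℝ E]
  {H : Type*} [TopologicalSpace H] {I : ModelWithCorners ℝ E H}
  {G : Type*} [TopologicalSpace G] [ChartedSpace H G] [Group G]

/-! ### Left-invariant tensor fields -/

theorem OneForm.IsLeftInvariant.apply_invariant {α : OneForm I G} (hα : α.IsLeftInvariant)
    (x : G) (u : GroupLieAlgebra I G) : α x (mulInvariantVectorField u x) = α 1 u := by
  -- Left translation by x lands in the tangent space at `x * 1`, which is only propositionally `x`;
  -- generalising the base point allows substitution, all fibres being `E`.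
  have key : ∀ y : G, y = x * 1 → α y (show E from dL x 1 u) = α 1 u := by
    rintro y rfl
    exact hα x 1 u
  exact key x (mul_one x).symm

theorem BilinField.IsLeftInvariant.apply_invariant {b : BilinField I G} (hb : b.IsLeftInvariant)
    (x : G) (u v : GroupLieAlgebra I G) :
    b x (mulInvariantVectorField u x) (mulInvariantVectorField v x) = b 1 u v := by
  have key : ∀ y : G, y = x * 1 → b y (show E from dL x 1 u) (show E from dL x 1 v) = b 1 u v := by
    rintro y rfl
    exact hb x 1 u v
  exact key x (mul_one x).symm

theorem EndField.IsLeftInvariant.apply_invariant {A : EndField I G} (hA : A.IsLeftInvariant)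
    (x : G) (u : GroupLieAlgebra I G) :
    A x (mulInvariantVectorField u x) = mulInvariantVectorField (A 1 u) x := by
  have key : ∀ y : G, y = x * 1 → (A y (show E from dL x 1 u) : E) = dL x 1 (A 1 u) := by
    rintro y rfl
    exact hA x 1 u
  exact key x (mul_one x).symm

theorem EndField.IsLeftInvariant.actField_invariant {A : EndField I G} (hA : A.IsLeftInvariant)
    (u : GroupLieAlgebra I G) :
    actField A (mulInvariantVectorField u) = mulInvariantVectorField (A 1 u) :=
  funext fun x => hA.apply_invariant x u

theorem dL_one (x : G) (u : TangentSpace I x) : (dL 1 x u : E) = u := by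
  have h : (fun y : G => 1 * y) = id := by funext y; simp
  simp only [dL]
  rw [h, mfderiv_id]
  rfl

theorem mulInvariantVectorField_one (u : GroupLieAlgebra I G) :
    mulInvariantVectorField u 1 = u :=
  dL_one (1 : G) u

theorem dirDeriv_const {G : Type*} [TopologicalSpace G] [ChartedSpace H G] (c : ℝ) (x : G) (u :
  TangentSpace I x) :
    dirDeriv (fun _ : G => c) x u = 0 := by
  rw [dirDeriv, mfderiv_const]
  rfl

/-! ### Left translation identifies each tangent space with the Lie algebra -/

variable [LieGroup I (minSmoothness ℝ 3) G]

theorem mdifferentiable_mul_left (a : G) : MDifferentiable I I (fun y : G => a * y) := by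
  have M : minSmoothness ℝ 3 ≠ 0 := lt_of_lt_of_le (by simp) le_minSmoothness |>.ne'
  exact contMDiff_mul_left.mdifferentiable M

theorem dL_dL (a b x : G) (u : TangentSpace I x) :
    (dL a (b * x) (dL b x u) : E) = dL (a * b) x u := by
  have h : (fun y : G => a * b * y) = (fun y => a * y) ∘ fun y => b * y := by
    funext y
    simp [mul_assoc]
  have := mfderiv_comp (I := I) (I' := I) (I'' := I) x
    ((mdifferentiable_mul_left (I := I) a) (b * x)) ((mdifferentiable_mul_left (I := I) b) x)
  simp only [dL]
  rw [h, this]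
  rfl

theorem dL_invariant (a x : G) (u : GroupLieAlgebra I G) :
    dL a x (mulInvariantVectorField u x) = mulInvariantVectorField u (a * x) := by
  have key : ∀ y : G, y = x * 1 → (dL (I := I) a y (show E from dL x 1 u) : E) = dL (a * x) 1 u :=
  by
    rintro y rfl
    exact dL_dL a x 1 u
  exact key x (mul_one x).symm

variable (I) in
/-- The linear equivalence between the Lie algebra and the tangent space at `x` given by left
translation. -/
def invariantEquiv (x : G) : GroupLieAlgebra I G ≃ₗ[ℝ] TangentSpace I x where
  toFun u := mulInvariantVectorField u x
  map_add' u v := by rw [mulInvariantVectorField_add]; rfl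
  map_smul' c u := by rw [mulInvariantVectorField_smul]; rfl
  invFun u := (dL x⁻¹ x u : E)
  left_inv u := by
    have key : ∀ y : G, y = 1 → (mulInvariantVectorField (I := I) u y : E) = u := by
      rintro y rfl
      exact mulInvariantVectorField_one u
    have h := dL_invariant x⁻¹ x u
    have h' := key (x⁻¹ * x) (inv_mul_cancel x)
    exact (congrArg (fun v : TangentSpace I (x⁻¹ * x) => (v : E)) h).trans h'
  right_inv u := by
    have key : ∀ y : G, y = x⁻¹ * x → (dL (I := I) x y (show E from dL x⁻¹ x u) : E) = u := by
      rintro y rfl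
      rw [dL_dL x x⁻¹ x u]
      have key' : ∀ a : G, a = 1 → (dL a x u : E) = u := by
        rintro a rfl
        exact dL_one x u
      exact key' _ (mul_inv_cancel x)
    exact key 1 (inv_mul_cancel x).symm

theorem invariantEquiv_apply (x : G) (u : GroupLieAlgebra I G) :
    invariantEquiv I x u = mulInvariantVectorField u x := rfl

theorem leftExt_eq (x : G) (u : TangentSpace I x) :
    leftExt x u = mulInvariantVectorField ((invariantEquiv I x).symm u) := rfl

theorem leftExt_invariant (x : G) (u : GroupLieAlgebra I G) :
    leftExt x (mulInvariantVectorField u x) = mulInvariantVectorField u := by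
  rw [leftExt_eq, ← invariantEquiv_apply, LinearEquiv.symm_apply_apply]

theorem exists_invariant_eq (x : G) (u : TangentSpace I x) :
    ∃ v : GroupLieAlgebra I G, mulInvariantVectorField v x = u :=
  (invariantEquiv I x).surjective u

/-- The one-form metrically dual to a left-invariant vector field. -/
def BilinField.dualForm (b : BilinField I G) (u : GroupLieAlgebra I G) : OneForm I G :=
  fun x => b x (mulInvariantVectorField u x)

theorem BilinField.IsLeftInvariant.dualForm {b : BilinField I G} (hb : b.IsLeftInvariant)
    (u : GroupLieAlgebra I G) : (b.dualForm u).IsLeftInvariant := by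
  intro a x v
  rw [BilinField.dualForm, ← dL_invariant]
  exact hb a x _ v

/-! ### Differential operators on left-invariant fields -/

variable [CompleteSpace E]

theorem mlieBracket_invariant (u v : GroupLieAlgebra I G) :
    VectorField.mlieBracket I (mulInvariantVectorField u) (mulInvariantVectorField v)
      = mulInvariantVectorField ⁅u, v⁆ :=
  (mulInvariantVector_mlieBracket u v).symm

theorem OneForm.IsLeftInvariant.dOne_invariant {α : OneForm I G} (hα : α.IsLeftInvariant) (x : G)
    (u v : GroupLieAlgebra I G) :
    dOne α x (mulInvariantVectorField u x) (mulInvariantVectorField v x) = -α 1 ⁅u, v⁆ := by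
  simp only [dOne, leftExt_invariant, mlieBracket_invariant, hα.apply_invariant, dirDeriv_const]
  ring

theorem nijenhuis_invariant {J : EndField I G} (hJ : J.IsLeftInvariant) (x : G)
    (u v : GroupLieAlgebra I G) :
    nijenhuis J x (mulInvariantVectorField u x) (mulInvariantVectorField v x)
      = mulInvariantVectorField (lieNijenhuis (J 1).toLinearMap u v) x := by
  simp only [nijenhuis, leftExt_invariant, hJ.actField_invariant, mlieBracket_invariant,
    hJ.apply_invariant, lieNijenhuis_apply]
  simp only [← invariantEquiv_apply, map_sub]
  rfl

theorem dTwo_invariant {η : BilinField I G} (hη : η.IsLeftInvariant) (x : G)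
    (u v w : GroupLieAlgebra I G) :
    dTwo η x (mulInvariantVectorField u x) (mulInvariantVectorField v x)
      (mulInvariantVectorField w x) = -η 1 ⁅u, v⁆ w + η 1 ⁅u, w⁆ v - η 1 ⁅v, w⁆ u := by
  simp only [dTwo, leftExt_invariant, mlieBracket_invariant, hη.apply_invariant, dirDeriv_const]
  ring

theorem koszul_invariant {g : BilinField I G} (hg : g.IsLeftInvariant) (x : G)
    (u v w : GroupLieAlgebra I G) :
    koszul g (mulInvariantVectorField u) (mulInvariantVectorField v)
      (mulInvariantVectorField w) x = g 1 ⁅u, v⁆ w - g 1 ⁅v, w⁆ u + g 1 ⁅w, u⁆ v := by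
  simp only [koszul, mlieBracket_invariant, hg.apply_invariant, dirDeriv_const]
  ring

theorem leviCivita_invariant {g : BilinField I G} (hg : g.IsLeftInvariant)
    (hpos : ∀ (x : G) (u : TangentSpace I x), u ≠ 0 → 0 < g x u u)
    {u v d : GroupLieAlgebra I G}
    (hd : ∀ w, 2 * g 1 d w = g 1 ⁅u, v⁆ w - g 1 ⁅v, w⁆ u + g 1 ⁅w, u⁆ v) :
    leviCivita g (mulInvariantVectorField u) (mulInvariantVectorField v)
      = mulInvariantVectorField d := by
  funext x
  have hspec : ∀ w : TangentSpace I x, 2 * g x (mulInvariantVectorField d x) w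
      = koszul g (mulInvariantVectorField u) (mulInvariantVectorField v) (leftExt x w) x := by
    intro w
    obtain ⟨w, rfl⟩ := exists_invariant_eq x w
    rw [leftExt_invariant, koszul_invariant hg, hg.apply_invariant, hd]
  -- Since d solves the Koszul equation, the chosen vector also does. Positivity of g gives
  -- uniqueness: the difference of the two solutions is orthogonal to itself.
  have heps := Classical.epsilon_spec (p := fun v' : TangentSpace I x =>
    ∀ w : TangentSpace I x, 2 * g x v' w = koszul g (mulInvariantVectorField u)
      (mulInvariantVectorField v) (leftExt x w) x) ⟨_, hspec⟩
  change ∀ w : TangentSpace I x, 2 * g x (leviCivita g (mulInvariantVectorField u)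
    (mulInvariantVectorField v) x) w = _ at heps
  by_contra hne
  have h0 := hpos x _ (sub_ne_zero.2 hne)
  have h1 := heps (leviCivita g (mulInvariantVectorField u) (mulInvariantVectorField v) x
    - mulInvariantVectorField d x)
  have h2 := hspec (leviCivita g (mulInvariantVectorField u) (mulInvariantVectorField v) x
    - mulInvariantVectorField d x)
  have h3 : ∀ a b w : TangentSpace I x, g x (a - b) w = g x a w - g x b w := fun a b w => by
    rw [(g x).map_sub]
    rfl
  rw [h3] at h0
  linarith

theorem curvature_invariant {g : BilinField I G} (hg : g.IsLeftInvariant)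
    (hpos : ∀ (x : G) (u : TangentSpace I x), u ≠ 0 → 0 < g x u u)
    {D : GroupLieAlgebra I G →ₗ[ℝ] GroupLieAlgebra I G →ₗ[ℝ] GroupLieAlgebra I G}
    (hD : ∀ u v w, 2 * g 1 (D u v) w = g 1 ⁅u, v⁆ w - g 1 ⁅v, w⁆ u + g 1 ⁅w, u⁆ v)
    (u v w : GroupLieAlgebra I G) :
    curvature g (mulInvariantVectorField u) (mulInvariantVectorField v)
      (mulInvariantVectorField w) = mulInvariantVectorField (lieCurvature D v w u) := by
  have hL := fun u v => leviCivita_invariant hg hpos (hD u v)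
  simp only [curvature, mlieBracket_invariant, hL]
  funext x
  simp only [Pi.sub_apply, lieCurvature_apply]
  simp only [← invariantEquiv_apply, map_sub]

theorem ricci_invariant [FiniteDimensional ℝ E] {g : BilinField I G} (hg : g.IsLeftInvariant)
    (hpos : ∀ (x : G) (u : TangentSpace I x), u ≠ 0 → 0 < g x u u)
    {D : GroupLieAlgebra I G →ₗ[ℝ] GroupLieAlgebra I G →ₗ[ℝ] GroupLieAlgebra I G}
    (hD : ∀ u v w, 2 * g 1 (D u v) w = g 1 ⁅u, v⁆ w - g 1 ⁅v, w⁆ u + g 1 ⁅w, u⁆ v)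
    (x : G) (u v : GroupLieAlgebra I G) :
    ricci g x (mulInvariantVectorField u x) (mulInvariantVectorField v x)
      = LinearMap.trace ℝ _ (lieCurvature D u v) := by
  let b : Module.Basis (Fin (Module.finrank ℝ E)) ℝ (TangentSpace I x) := Module.finBasis ℝ E
  change ∑ i, b.coord i (curvature g (leftExt x (b i)) (leftExt x (mulInvariantVectorField u x))
    (leftExt x (mulInvariantVectorField v x)) x) = _
  -- The trace does not depend on the basis, so it is computed in the basis of the tangent space at
  -- x pulled back to the Lie algebra.
  rw [LinearMap.trace_eq_matrix_trace ℝ (b.map (invariantEquiv I x).symm), Matrix.trace]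
  refine Finset.sum_congr rfl fun i _ => ?_
  rw [leftExt_invariant, leftExt_invariant, leftExt_eq, curvature_invariant hg hpos hD,
    Matrix.diag_apply, LinearMap.toMatrix_apply, ← invariantEquiv_apply]
  simp

/-! ### The almost Kähler structure on the Lie algebra -/

/-- The bilinear form on the Lie algebra defined by a field of bilinear forms. -/
def BilinField.lieForm (b : BilinField I G) :
    GroupLieAlgebra I G →ₗ[ℝ] GroupLieAlgebra I G →ₗ[ℝ] ℝ :=
  LinearMap.mk₂ ℝ (fun u v => b 1 u v)
    (fun u u' v => by rw [(b 1).map_add]; rfl)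
    (fun c u v => by rw [(b 1).map_smul]; rfl)
    (fun u v v' => (b 1 u).map_add v v')
    (fun c u v => (b 1 u).map_smul c v)

/-- The endomorphism of the Lie algebra defined by a field of endomorphisms. -/
def EndField.lieEnd (A : EndField I G) : GroupLieAlgebra I G →ₗ[ℝ] GroupLieAlgebra I G :=
  (A 1).toLinearMap

theorem InvariantAlmostKahler.isAlmostKahler (S : InvariantAlmostKahler I G) :
    IsAlmostKahler S.g.lieForm S.J.lieEnd where
  symm := S.g_symm 1
  pos := S.g_pos 1
  sq := S.J_sq 1
  alt u := (S.compat 1 u u).symm.trans (S.Ω_alt 1 u)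
  closed u v w := by
    have h := S.Ω_closed 1 (mulInvariantVectorField u 1) (mulInvariantVectorField v 1)
      (mulInvariantVectorField w 1)
    rw [dTwo_invariant S.Ω_inv, S.compat, S.compat, S.compat] at h
    change S.g 1 (S.J 1 ⁅u, v⁆) w - S.g 1 (S.J 1 ⁅u, w⁆) v + S.g 1 (S.J 1 ⁅v, w⁆) u = 0
    linarith only [h]

theorem InvariantAlmostKahler.IsStrict.exists_lieNijenhuis_ne_zero
    {S : InvariantAlmostKahler I G} (hS : S.IsStrict) :
    ∃ u v, lieNijenhuis S.J.lieEnd u v ≠ 0 := by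
  obtain ⟨x, u, v, h⟩ := hS
  obtain ⟨u, rfl⟩ := exists_invariant_eq x u
  obtain ⟨v, rfl⟩ := exists_invariant_eq x v
  refine ⟨u, v, fun h0 => h ?_⟩
  rw [nijenhuis_invariant S.J_inv]
  change invariantEquiv I x (lieNijenhuis S.J.lieEnd u v) = 0
  rw [h0, map_zero]

theorem InvariantAlmostKahler.ricci_frame [FiniteDimensional ℝ E] (S : InvariantAlmostKahler I G)
    (hE : Module.finrank ℝ E = 4) {f : Fin 4 → GroupLieAlgebra I G}
    (hf : IsUnitaryFrame S.g.lieForm S.J.lieEnd f) (x : G) (i j : Fin 4) :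
    ricci S.g x (mulInvariantVectorField (f i) x) (mulInvariantVectorField (f j) x)
      = ricciCoeff (structureConstants S.g.lieForm f) i j := by
  rw [ricci_invariant S.g_inv S.g_pos (D := lieLeviCivita S.g.lieForm f)
    (fun u v w => hf.lieLeviCivita_spec hE u v w), hf.trace_lieCurvature hE]

theorem InvariantAlmostKahler.RicciJInvariant.ricciCoeffInvariant [FiniteDimensional ℝ E]
    {S : InvariantAlmostKahler I G} (hS : S.RicciJInvariant) (hE : Module.finrank ℝ E = 4)
    {f : Fin 4 → GroupLieAlgebra I G} (hf : IsUnitaryFrame S.g.lieForm S.J.lieEnd f) :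
    RicciCoeffInvariant (structureConstants S.g.lieForm f) := by
  have hr := S.ricci_frame hE hf 1
  have hb : ∀ u v : GroupLieAlgebra I G, ricci S.g 1 u v
      = LinearMap.trace ℝ _ (lieCurvature (lieLeviCivita S.g.lieForm f) u v) := by
    intro u v
    rw [← ricci_invariant S.g_inv S.g_pos (D := lieLeviCivita S.g.lieForm f)
      (fun u v w => hf.lieLeviCivita_spec hE u v w) 1 u v, mulInvariantVectorField_one,
      mulInvariantVectorField_one]
  have hJ : ∀ u v : GroupLieAlgebra I G, ricci S.g 1 (S.J.lieEnd u) (S.J.lieEnd v)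
      = ricci S.g 1 u v := hS 1
  simp only [mulInvariantVectorField_one] at hr
  simp only [hb] at hr hJ
  have h0 := hf.J₀
  have h1 := hf.J₁ S.isAlmostKahler
  have h2 := hf.J₂
  have h3 := hf.J₃ S.isAlmostKahler
  have e00 := hJ (f 0) (f 0)
  have e22 := hJ (f 2) (f 2)
  have e01 := hJ (f 0) (f 1)
  have e23 := hJ (f 2) (f 3)
  have e20 := hJ (f 2) (f 0)
  have e30 := hJ (f 3) (f 0)
  simp only [h0, h1, h2, h3, lieCurvature_neg_left, lieCurvature_neg_right, map_neg, hr]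
    at e00 e22 e01 e23 e20 e30
  constructor <;> linarith only [e00, e22, e01, e23, e20, e30]

end LieGroup

end LieAK

end

/-! ### The theorem on the group -/

theorem theorem2p1 {G : Type*} [TopologicalSpace G] [ChartedSpace (EuclideanSpace ℝ (Fin 4)) G]
    [Group G] [LieGroup (𝓡 4) ∞ G] [SimplyConnectedSpace G]
    (S : LieAK.InvariantAlmostKahler (𝓡 4) G) (hstrict : S.IsStrict) (hRic : S.RicciJInvariant) :
    ∃ (e : Fin 4 → LieAK.OneForm (𝓡 4) G) (f : Fin 4 → LieAK.VField (𝓡 4) G) (s t : ℝ),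
      t ≠ 0 ∧
      (∀ i, (e i).IsLeftInvariant) ∧
      LieAK.IsOrthonormalCoframe S.g e f ∧
      (∀ (x : G) (u v : TangentSpace (𝓡 4) x),
        S.Ω x u v = LieAK.wedge (e 0) (e 1) x u v + LieAK.wedge (e 2) (e 3) x u v) ∧
      LieAK.actForm S.J (e 0) = e 1 ∧
      LieAK.actForm S.J (e 2) = e 3 ∧
      (∀ (x : G) (u v : TangentSpace (𝓡 4) x),
        LieAK.dOne (e 0) x u v =
          -s * (LieAK.wedge (e 0) (e 2) x u v - LieAK.wedge (e 1) (e 3) x u v)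
            + (-s ^ 2 + t ^ 2) / (2 * t) * LieAK.wedge (e 0) (e 3) x u v
            + t * LieAK.wedge (e 1) (e 2) x u v) ∧
      (∀ (x : G) (u v : TangentSpace (𝓡 4) x),
        LieAK.dOne (e 1) x u v =
          -(s ^ 2 / t) * LieAK.wedge (e 0) (e 2) x u v
            + s * (LieAK.wedge (e 0) (e 3) x u v + LieAK.wedge (e 1) (e 2) x u v)
            + (s ^ 2 - t ^ 2) / (2 * t) * LieAK.wedge (e 1) (e 3) x u v) ∧
      (∀ (x : G) (u v : TangentSpace (𝓡 4) x),
        LieAK.dOne (e 2) x u v = (t ^ 2 + s ^ 2) / t * LieAK.wedge (e 2) (e 3) x u v) ∧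
      (∀ (x : G) (u v : TangentSpace (𝓡 4) x), LieAK.dOne (e 3) x u v = 0) ∧
      (∀ (x : G) (i j : Fin 4),
        LieAK.ricci S.g x (f i x) (f j x) =
          Matrix.diagonal
            ![0, 0, -3 * (t ^ 2 + s ^ 2) ^ 2 / (2 * t ^ 2),
              -3 * (t ^ 2 + s ^ 2) ^ 2 / (2 * t ^ 2)] i j) := by
  have : LieGroup (𝓡 4) (minSmoothness ℝ 3) G := by
    rw [minSmoothness_of_isRCLikeNormedField]
    exact LieGroup.of_le (n := ∞) (ENat.LEInfty.out)
  have hE : Module.finrank ℝ (EuclideanSpace ℝ (Fin 4)) = 4 := by simp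
  have hS := S.isAlmostKahler
  obtain ⟨f, t, ht, hf, hC⟩ := hS.exists_normal_frame hE hstrict.exists_lieNijenhuis_ne_zero
    fun f hf => hRic.ricciCoeffInvariant hE hf
  have hinv : ∀ i, (S.g.dualForm (f i)).IsLeftInvariant := fun i => S.g_inv.dualForm (f i)
  have he : ∀ i x a, S.g.dualForm (f i) x (mulInvariantVectorField a x) = S.g.lieForm (f i) a :=
    fun i x a => S.g_inv.apply_invariant x (f i) a
  have hd : ∀ i x a b, LieAK.dOne (S.g.dualForm (f i)) x (mulInvariantVectorField a x)
      (mulInvariantVectorField b x) = -S.g.lieForm (f i) ⁅a, b⁆ := fun i x a b => by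
    rw [(hinv i).dOne_invariant, ← he i 1 ⁅a, b⁆, LieAK.mulInvariantVectorField_one]
  have hact : ∀ i j, S.J.lieEnd (f i) = f j →
      LieAK.actForm S.J (S.g.dualForm (f i)) = S.g.dualForm (f j) := fun i j hij => by
    funext x
    ext u
    obtain ⟨a, rfl⟩ := LieAK.exists_invariant_eq x u
    rw [he, ← hij, hS.skew]
    change -(S.g.dualForm (f i) x (S.J x (mulInvariantVectorField a x))) = _
    rw [S.J_inv.apply_invariant, he]
    rfl
  have hc : ∀ i j k, LieAK.structureConstants S.g.lieForm f j i k
      = -LieAK.structureConstants S.g.lieForm f i j k := fun i j k => by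
    rw [LieAK.structureConstants, ← lie_skew, map_neg]
    rfl
  -- The coframe is metrically dual to the invariant extension of the normal frame. The phases being
  -- already fixed, s = 0 serves as witness.
  refine ⟨fun i => S.g.dualForm (f i), fun i => mulInvariantVectorField (f i), 0, t, ht, hinv,
    ⟨fun x => ?_, fun x i j => ?_, fun x i j => ?_⟩, fun x u v => ?_, hact 0 1 hf.J₀, hact 2 3
      hf.J₂,
    fun x u v => ?_, fun x u v => ?_, fun x u v => ?_, fun x u v => ?_, fun x i j => ?_⟩
  · have h := congrArg (Submodule.map (LieAK.invariantEquiv (𝓡 4) x).toLinearMap)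
      (hf.span_eq_top hE)
    rw [Submodule.map_span, ← Set.range_comp, Submodule.map_top, LinearEquiv.range] at h
    exact h
  · rw [he, hf.orthonormal]
  · exact (he i x (f j)).trans (hf.orthonormal i j)
  · obtain ⟨a, rfl⟩ := LieAK.exists_invariant_eq x u
    obtain ⟨b, rfl⟩ := LieAK.exists_invariant_eq x v
    rw [S.Ω_inv.apply_invariant, S.compat]
    simp only [LieAK.wedge, he]
    exact hf.fundamentalForm_eq hS hE a b
  · obtain ⟨a, rfl⟩ := LieAK.exists_invariant_eq x u
    obtain ⟨b, rfl⟩ := LieAK.exists_invariant_eq x v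
    rw [hd, hf.apply_lie_eq hS hE]
    simp [LieAK.wedge, he, hC.c01, hC.c02, hC.c03, hC.c12, hC.c13, hC.c23]
    field_simp
    ring
  · obtain ⟨a, rfl⟩ := LieAK.exists_invariant_eq x u
    obtain ⟨b, rfl⟩ := LieAK.exists_invariant_eq x v
    rw [hd, hf.apply_lie_eq hS hE]
    simp [LieAK.wedge, he, hC.c01, hC.c02, hC.c03, hC.c12, hC.c13, hC.c23]
    field_simp
    ring
  · obtain ⟨a, rfl⟩ := LieAK.exists_invariant_eq x u
    obtain ⟨b, rfl⟩ := LieAK.exists_invariant_eq x v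
    rw [hd, hf.apply_lie_eq hS hE]
    simp [LieAK.wedge, he, hC.c01, hC.c02, hC.c03, hC.c12, hC.c13, hC.c23]
    field_simp
  · obtain ⟨a, rfl⟩ := LieAK.exists_invariant_eq x u
    obtain ⟨b, rfl⟩ := LieAK.exists_invariant_eq x v
    rw [hd, hf.apply_lie_eq hS hE]
    simp [hC.c01, hC.c02, hC.c03, hC.c12, hC.c13, hC.c23]
  · rw [S.ricci_frame hE hf, hC.ricciCoeff_eq hc]
    have : -3 * (t ^ 2 + 0 ^ 2) ^ 2 / (2 * t ^ 2) = -3 * t ^ 2 / 2 := by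
      field_simp
      ring
    rw [this]
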